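/- Let $\Sigma=(\Sigma_0,\Sigma_1,\Sigma_2)$ be a $2$-polygraph: a directed graph $(\Sigma_0,\Sigma_1)$ with a set $\Sigma_2$ of rules $\varphi:s\Rightarrow t$ between parallel $1$-cells of the free category $\Sigma_1^*$. Write $\Sigma_2^*$ (resp. $\Sigma_2^\top$) for the free $2$-category (resp. free $(2,1)$-category) on $\Sigma$; $\star_1$ is the vertical composition and juxtaposition the horizontal one. Rewriting steps are the $2$-cells $u\varphi v$ with $\varphi\in\Sigma_2$ and $u,v\in\Sigma_1^*$; rewriting sequences are the finite composable sequences of steps (possibly empty). Assume that $\Sigma$ is quasi-convergent, that is, confluent (any two rewriting sequences with the same source can be completed by rewriting sequences to a common target) and quasi-terminating (every infinite sequence $(u_n)_n$ of $1$-cells with a step from $u_n$ to $u_{n+1}$ for all $n$ contains some $1$-cell infinitely often). *Labelling.* A quasi-normal form is a $1$-cell $u$ such that for each step $u\Rightarrow v$ there is a rewriting sequence from $v$ to $u$. Fix for every $1$-cell $u$ a quasi-normal form $\widetilde u$ into which $u$ rewrites, with $\widetilde u=\widetilde v$ whenever $u$ and $v$ are equal in the category presented by $\Sigma$. The associated quasi-normal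 form labelling sends a step $f$ with target $v$ to $\psi^{\mathrm{QNF}}(f)=d(v,\widetilde v)\in\mathbb N$, the length of a shortest rewriting sequence from $v$ to $\widetilde v$. *Branchings.* A local branching is a pair $(f,g)$ of steps with the same source. It is aspherical if $f=g$; it is a Peiffer branching if, up to exchanging its two members, it is of the form $(fv,ug)$ with steps $f:u\Rightarrow u'$ and $g:v\Rightarrow v'$. A critical branching is a local branching, neither aspherical nor Peiffer, that is minimal for the order $(f,g)\sqsubseteq(wfw',wgw')$. A confluence diagram $(f\cdot f',g\cdot g')$ of $(f,g)$ consists of rewriting sequences $f'$, $g'$ from the targets of $f$, $g$ to a common target; it is strictly decreasing if every step of $f'$ has a label $<\psi^{\mathrm{QNF}}(f)$ and every step of $g'$ has a label $<\psi^{\mathrm{QNF}}(g)$. The labelling is compatible with contexts if, for every strictly decreasing confluence diagram $(f\cdot f',g\cdot g')$ of a local branching and all composable $1$-cells $u_1,u_2$, the diagram $(u_1fu_2\cdot u_1f'u_2,\,u_1gu_2\cdot u_1g'u_2)$ is strictly decreasing. *Loops.* A $2$-loop is a $2$-cell of $\Sigma_2^*$ with equal source and target. It is elementary if (i) $f=g\star_1h\star_1k$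 with $h$ a $2$-loop implies that $h$ is an identity or $h=f$, and (ii) $f=ugv$ with $g$ a $2$-loop and $u,v$ $1$-cells implies that $u$ and $v$ are both identities. Equivalence of $2$-loops is the equivalence relation generated by circular permutation of the steps in a decomposition into steps. *Completion.* A strictly decreasing Squier completion $\mathcal S^{sd}(\Sigma,\psi^{\mathrm{QNF}})$ is a $(3,1)$-polygraph extending $\Sigma$ by the following $3$-cells: for each critical branching $(f,g)$ (branchings being considered up to exchanging their two members; choosing a $3$-cell for both $(f,g)$ and $(g,f)$ is also allowed) one $3$-cell $f\star_1f'\Rrightarrow g\star_1g'$, where $(f\cdot f',g\cdot g')$ is a chosen strictly decreasing confluence diagram; and one $3$-cell $\alpha\Rrightarrow 1$ for one chosen elementary $2$-loop $\alpha$ in each equivalence class of elementary $2$-loops. Let $\mathcal S=\mathcal S^{sd}(\Sigma,\psi^{\mathrm{QNF}})$ be any such completion. Suppose that $\psi^{\mathrm{QNF}}$ is compatible with contexts and that $(\Sigma,\psi^{\mathrm{QNF}})$ is Peiffer decreasing with respect to $\mathcal S$: for all steps $f:u\Rightarrow u'$ and $g:v\Rightarrow v'$ with $u,v$ composable, there is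 a strictly decreasing confluence diagram $(fv\cdot f',ug\cdot g')$ of $(fv,ug)$ such that $u'g\star_1(fv')^-$ and $f'\star_1(g')^-$ are identified by the congruence on the $2$-cells of $\Sigma_2^\top$ generated by the $3$-cells of $\mathcal S$. Then $\mathcal S$ is a coherent presentation of the category presented by $\Sigma$ (the quotient of $\Sigma_1^*$ by the congruence generated by $\Sigma_2$): its underlying $2$-polygraph presents that category, and for every pair $(f,g)$ of parallel $2$-cells of $\Sigma_2^\top$ there is a $3$-cell from $f$ to $g$ in the free $(3,1)$-category generated by $\mathcal S$. -/

import Mathlib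

open CategoryTheory

universe u v w t

/-! ## Polygraphs and their 1-cells -/

/-- A 1-polygraph: a directed graph. -/
structure OnePolygraph where
  Obj : Type u
  Gen : Obj → Obj → Type v

namespace OnePolygraph

instance instQuiverObj (P : OnePolygraph.{u, v}) : Quiver.{v} P.Obj := ⟨P.Gen⟩

/-- The 1-cells of the free category on a 1-polygraph. -/
def OneCell (P : OnePolygraph.{u, v}) (x y : P.Obj) : Type (max u v) := Quiver.Path x y

namespace OneCell

variable {P : OnePolygraph.{u, v}} {x y z a b : P.Obj}

/-- The identity 1-cell. -/
def id (x : P.Obj) : P.OneCell x x := Quiver.Path.nil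

/-- The 0-composition of 1-cells. -/
def comp (p : P.OneCell x y) (q : P.OneCell y z) : P.OneCell x z := Quiver.Path.comp p q

theorem comp_assoc (p : P.OneCell x y) (q : P.OneCell y z) (r : P.OneCell z a) :
    (p.comp q).comp r = p.comp (q.comp r) := Quiver.Path.comp_assoc p q r

/-- The 1-cell `u p v`. -/
def ctx (u : P.OneCell x a) (p : P.OneCell a b) (v : P.OneCell b y) : P.OneCell x y :=
  (u.comp p).comp v

/-- The 1-cell `u` is an identity. -/
def IsIdentity (u : P.OneCell x y) : Prop := Quiver.Path.length u = 0

end OneCell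

end OnePolygraph

/-- A 2-polygraph: a 1-polygraph with a globular extension of its free category, given as the
family of the sets of 2-cells with prescribed (parallel) source and target. -/
structure TwoPolygraph extends OnePolygraph.{u, v} where
  Rule : ∀ {x y : Obj}, toOnePolygraph.OneCell x y → toOnePolygraph.OneCell x y → Type w

namespace TwoPolygraph

open OnePolygraph

variable {P : TwoPolygraph.{u, v, w}} {x y z a b : P.Obj}

/-! ## The presented category -/

/-- The relation on the free category given by the 2-cells. -/
def ruleRel (P : TwoPolygraph.{u, v, w}) : HomRel (Paths P.Obj) :=
  fun x y p q => Nonempty (P.Rule (x := x) (y := y) p q)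

/-- The category presented by `P`: the quotient of the free category by the congruence generated
by the 2-cells. -/
abbrev PresentedCategory (P : TwoPolygraph.{u, v, w}) := CategoryTheory.Quotient P.ruleRel

/-- Two 1-cells are congruent if they are equal in the presented category. -/
def Congruent (p q : P.OneCell x y) : Prop :=
  (CategoryTheory.Quotient.functor P.ruleRel).map (X := x) (Y := y) p =
    (CategoryTheory.Quotient.functor P.ruleRel).map (X := x) (Y := y) q

/-- `P` is a presentation of `C`: the category presented by `P` is isomorphic to `C`. -/
def IsPresentationOf (P : TwoPolygraph.{u, v, w}) (C : Type*) [Category* C] : Prop :=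
  ∃ (F : P.PresentedCategory ⥤ C) (G : C ⥤ P.PresentedCategory), F ⋙ G = 𝟭 _ ∧ G ⋙ F = 𝟭 _

/-! ## Rewriting steps and rewriting sequences -/

/-- A rewriting step `left rule right` from `p` to `q`. -/
structure Step (P : TwoPolygraph.{u, v, w}) {x y : P.Obj} (p q : P.OneCell x y) :
    Type (max u v w) where
  {c d : P.Obj}
  {s t : P.OneCell c d}
  left : P.OneCell x c
  rule : P.Rule s t
  right : P.OneCell d y
  source_eq : p = left.ctx s right
  target_eq : q = left.ctx t right

instance instQuiverOneCell : Quiver.{max u v w} (P.OneCell x y) := ⟨P.Step⟩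

namespace Step

/-- The rewriting step `u f`. -/
def whiskerLeft (u : P.OneCell x y) {p q : P.OneCell y z} (f : P.Step p q) :
    P.Step (u.comp p) (u.comp q) where
  left := u.comp f.left
  rule := f.rule
  right := f.right
  source_eq := by
    conv_lhs => rw [f.source_eq]
    simp only [OneCell.ctx, OneCell.comp_assoc]
  target_eq := by
    conv_lhs => rw [f.target_eq]
    simp only [OneCell.ctx, OneCell.comp_assoc]

/-- The rewriting step `f v`. -/
def whiskerRight {p q : P.OneCell x y} (f : P.Step p q) (v : P.OneCell y z) :
    P.Step (p.comp v) (q.comp v) where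
  left := f.left
  rule := f.rule
  right := f.right.comp v
  source_eq := by
    conv_lhs => rw [f.source_eq]
    simp only [OneCell.ctx, OneCell.comp_assoc]
  target_eq := by
    conv_lhs => rw [f.target_eq]
    simp only [OneCell.ctx, OneCell.comp_assoc]

/-- The rewriting step `u f v`. -/
def ctx (u : P.OneCell x a) {p q : P.OneCell a b} (f : P.Step p q) (v : P.OneCell b y) :
    P.Step (u.ctx p v) (u.ctx q v) :=
  (f.whiskerLeft u).whiskerRight v

end Step

/-- A (finite) rewriting sequence from `p` to `q`. -/
abbrev RewSeq (p q : P.OneCell x y) : Type (max u v w) := Quiver.Path p q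

/-- Steps of `P.OneCell a b` are sent to steps of `P.OneCell x y` by a context. -/
def ctxStep (u : P.OneCell x a) (v : P.OneCell b y) : P.OneCell a b ⥤q P.OneCell x y where
  obj p := u.ctx p v
  map f := Step.ctx u f v

/-- The rewriting sequence `u f v`. -/
def RewSeq.ctx (u : P.OneCell x a) {p q : P.OneCell a b} (f : RewSeq p q) (v : P.OneCell b y) :
    RewSeq (u.ctx p v) (u.ctx q v) :=
  (ctxStep u v).mapPath f

/-! ## The free 2-category and the free (2,1)-category

The hom-category of the free 2-category at `(x, y)` is the free category on the rewriting steps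
between the 1-cells from `x` to `y`, modulo the exchange relations
`f q ⋆₁ p' g = p g ⋆₁ f q'` for steps `f : p ⇒ p'` and `g : q ⇒ q'`; for the free (2,1)-category
one starts from the free groupoid on the rewriting steps. The composition `⋆₁` is written `≫`. -/

/-- The squares of rewriting steps that the exchange relations make commute. -/
inductive ExchangeSquare : ∀ {x y : P.Obj} {p q q' r : P.OneCell x y},
    P.Step p q → P.Step q r → P.Step p q' → P.Step q' r → Prop
  | mk {x y z : P.Obj} {p p' : P.OneCell x y} {q q' : P.OneCell y z}
      (f : P.Step p p') (g : P.Step q q') :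
      ExchangeSquare (f.whiskerRight q) (g.whiskerLeft p') (g.whiskerLeft p) (f.whiskerRight q')

theorem Step.heq_of_data {p q p' q' : P.OneCell x y} (hp : p = p') (hq : q = q')
    (f : P.Step p q) (l : P.OneCell x f.c) (r : P.OneCell f.d y) (hl : f.left = l)
    (hr : f.right = r) (h₁ : p' = l.ctx f.s r) (h₂ : q' = l.ctx f.t r) :
    f ≍ (⟨l, f.rule, r, h₁, h₂⟩ : P.Step p' q') := by
  subst hp hq hl hr
  rfl

theorem ExchangeSquare.of_heq {y : P.Obj} {p p' : P.OneCell x y} {q q' : P.OneCell y z}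
    (f : P.Step p p') (g : P.Step q q') {o o₁ o₂ o' : P.OneCell x z}
    (h : o = p.comp q) (h₁ : o₁ = p'.comp q) (h₂ : o₂ = p.comp q') (h' : o' = p'.comp q')
    {a : P.Step o o₁} {b : P.Step o₁ o'} {c : P.Step o o₂} {d : P.Step o₂ o'}
    (ha : a ≍ f.whiskerRight q) (hb : b ≍ g.whiskerLeft p')
    (hc : c ≍ g.whiskerLeft p) (hd : d ≍ f.whiskerRight q') : ExchangeSquare a b c d := by
  subst h h₁ h₂ h'
  obtain rfl := eq_of_heq ha
  obtain rfl := eq_of_heq hb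
  obtain rfl := eq_of_heq hc
  obtain rfl := eq_of_heq hd
  exact .mk f g

/-- Exchange squares are stable under contexts. -/
theorem ExchangeSquare.ctx (l : P.OneCell x a) (r : P.OneCell b y)
    {p q q' s : P.OneCell a b} {f : P.Step p q} {g : P.Step q s} {f' : P.Step p q'}
    {g' : P.Step q' s} (h : ExchangeSquare f g f' g') :
    ExchangeSquare (f.ctx l r) (g.ctx l r) (f'.ctx l r) (g'.ctx l r) := by
  cases h with
  | mk f g =>
    refine ExchangeSquare.of_heq (f.whiskerLeft l) (g.whiskerRight r) ?_ ?_ ?_ ?_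
      (Step.heq_of_data ?_ ?_ _ _ _ ?_ ?_ _ _) (Step.heq_of_data ?_ ?_ _ _ _ ?_ ?_ _ _)
      (Step.heq_of_data ?_ ?_ _ _ _ ?_ ?_ _ _) (Step.heq_of_data ?_ ?_ _ _ _ ?_ ?_ _ _) <;>
    simp only [OneCell.ctx, OneCell.comp_assoc, Step.ctx, Step.whiskerLeft, Step.whiskerRight]

/-- The exchange relations on rewriting sequences. -/
inductive Exchange (x y : P.Obj) : HomRel (Paths (P.OneCell x y))
  | mk {p q q' r : P.OneCell x y} {f : P.Step p q} {g : P.Step q r} {f' : P.Step p q'}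
      {g' : P.Step q' r} (h : ExchangeSquare f g f' g') :
      Exchange x y ((Paths.of (P.OneCell x y)).map f ≫ (Paths.of (P.OneCell x y)).map g)
        ((Paths.of (P.OneCell x y)).map f' ≫ (Paths.of (P.OneCell x y)).map g')

/-- The exchange relations on the free groupoid on rewriting steps. -/
inductive ExchangeGrpd (x y : P.Obj) : HomRel (Quiver.FreeGroupoid (P.OneCell x y))
  | mk {p q q' r : P.OneCell x y} {f : P.Step p q} {g : P.Step q r} {f' : P.Step p q'}
      {g' : P.Step q' r} (h : ExchangeSquare f g f' g') :
      ExchangeGrpd x y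
        ((Quiver.FreeGroupoid.of (P.OneCell x y)).map f ≫
          (Quiver.FreeGroupoid.of (P.OneCell x y)).map g)
        ((Quiver.FreeGroupoid.of (P.OneCell x y)).map f' ≫
          (Quiver.FreeGroupoid.of (P.OneCell x y)).map g')

/-- The hom-category at `(x, y)` of the free 2-category on `P`. -/
abbrev FreeTwo (P : TwoPolygraph.{u, v, w}) (x y : P.Obj) :=
  CategoryTheory.Quotient (Exchange (P := P) x y)

/-- The hom-groupoid at `(x, y)` of the free (2,1)-category on `P`. -/
abbrev FreeTwoOne (P : TwoPolygraph.{u, v, w}) (x y : P.Obj) :=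
  CategoryTheory.Quotient (ExchangeGrpd (P := P) x y)

/-- A rewriting step as a 2-cell of the free 2-category. -/
def stepTwo (x y : P.Obj) : P.OneCell x y ⥤q P.FreeTwo x y :=
  Paths.of (P.OneCell x y) ⋙q (CategoryTheory.Quotient.functor _).toPrefunctor

/-- A rewriting step as a 2-cell of the free (2,1)-category. -/
def stepTwoOne (x y : P.Obj) : P.OneCell x y ⥤q P.FreeTwoOne x y :=
  Quiver.FreeGroupoid.of (P.OneCell x y) ⋙q (CategoryTheory.Quotient.functor _).toPrefunctor

/-- The 2-cells of the free 2-category from `p` to `q`. -/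
abbrev TwoCell (p q : P.OneCell x y) := (stepTwo x y).obj p ⟶ (stepTwo x y).obj q

/-- The 2-cells of the free (2,1)-category from `p` to `q`. -/
abbrev TwoOneCell (p q : P.OneCell x y) := (stepTwoOne x y).obj p ⟶ (stepTwoOne x y).obj q

theorem stepTwo_exchange {p q q' r : P.OneCell x y} {f : P.Step p q} {g : P.Step q r}
    {f' : P.Step p q'} {g' : P.Step q' r} (h : ExchangeSquare f g f' g') :
    (stepTwo x y).map f ≫ (stepTwo x y).map g = (stepTwo x y).map f' ≫ (stepTwo x y).map g' :=
  CategoryTheory.Quotient.sound _ (Exchange.mk h)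

theorem stepTwoOne_exchange {p q q' r : P.OneCell x y} {f : P.Step p q} {g : P.Step q r}
    {f' : P.Step p q'} {g' : P.Step q' r} (h : ExchangeSquare f g f' g') :
    (stepTwoOne x y).map f ≫ (stepTwoOne x y).map g =
      (stepTwoOne x y).map f' ≫ (stepTwoOne x y).map g' :=
  CategoryTheory.Quotient.sound _ (ExchangeGrpd.mk h)

/-- The functor out of a hom-category of the free 2-category extending a map on steps that
respects the exchange relations. -/
def FreeTwo.lift {D : Type*} [Category* D] (φ : P.OneCell x y ⥤q D)
    (hφ : ∀ {p q q' r : P.OneCell x y} {f : P.Step p q} {g : P.Step q r} {f' : P.Step p q'}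
      {g' : P.Step q' r}, ExchangeSquare f g f' g' →
        φ.map f ≫ φ.map g = φ.map f' ≫ φ.map g') : P.FreeTwo x y ⥤ D :=
  CategoryTheory.Quotient.lift _ (Paths.lift φ) (by
    have key : ∀ {p q : P.OneCell x y} (f : P.Step p q),
        (Paths.lift φ).map ((Paths.of (P.OneCell x y)).map f) = φ.map f := fun f =>
      Category.id_comp (φ.map f)
    rintro _ _ _ _ ⟨h⟩
    rw [Functor.map_comp, Functor.map_comp, key, key, key, key]
    exact hφ h)

/-- The functor out of a hom-groupoid of the free (2,1)-category extending a map on steps that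
respects the exchange relations. -/
def FreeTwoOne.lift {D : Type*} [Groupoid D] (φ : P.OneCell x y ⥤q D)
    (hφ : ∀ {p q q' r : P.OneCell x y} {f : P.Step p q} {g : P.Step q r} {f' : P.Step p q'}
      {g' : P.Step q' r}, ExchangeSquare f g f' g' →
        φ.map f ≫ φ.map g = φ.map f' ≫ φ.map g') : P.FreeTwoOne x y ⥤ D :=
  CategoryTheory.Quotient.lift _ (Quiver.FreeGroupoid.lift φ) (by
    have key : ∀ {p q : P.OneCell x y} (f : P.Step p q),
        (Quiver.FreeGroupoid.lift φ).map ((Quiver.FreeGroupoid.of (P.OneCell x y)).map f) =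
          φ.map f := fun f => Category.id_comp (φ.map f)
    rintro _ _ _ _ ⟨h⟩
    rw [Functor.map_comp, Functor.map_comp, key, key, key, key]
    exact hφ h)

/-- The canonical functors from the free 2-category to the free (2,1)-category. -/
def toTwoOne (x y : P.Obj) : P.FreeTwo x y ⥤ P.FreeTwoOne x y :=
  FreeTwo.lift (stepTwoOne x y) stepTwoOne_exchange

/-- The context `f ↦ u f v` on 2-cells of the free 2-category. -/
def ctxTwo (u : P.OneCell x a) (v : P.OneCell b y) : P.FreeTwo a b ⥤ P.FreeTwo x y :=
  FreeTwo.lift (ctxStep u v ⋙q stepTwo x y) fun h => stepTwo_exchange (h.ctx u v)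

/-- The context `f ↦ u f v` on 2-cells of the free (2,1)-category. -/
def ctxTwoOne (u : P.OneCell x a) (v : P.OneCell b y) : P.FreeTwoOne a b ⥤ P.FreeTwoOne x y :=
  FreeTwoOne.lift (ctxStep u v ⋙q stepTwoOne x y) fun h => stepTwoOne_exchange (h.ctx u v)

/-- The 2-cell `u f v` of the free 2-category. -/
def TwoCell.ctx (u : P.OneCell x a) {p q : P.OneCell a b} (f : TwoCell p q)
    (v : P.OneCell b y) : TwoCell (u.ctx p v) (u.ctx q v) :=
  (ctxTwo u v).map f

/-- The 2-cell `u f v` of the free (2,1)-category. -/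
def TwoOneCell.ctx (u : P.OneCell x a) {p q : P.OneCell a b} (f : TwoOneCell p q)
    (v : P.OneCell b y) : TwoOneCell (u.ctx p v) (u.ctx q v) :=
  (ctxTwoOne u v).map f

/-- A 2-cell of the free 2-category as a 2-cell of the free (2,1)-category. -/
def TwoCell.toTwoOneCell {p q : P.OneCell x y} (f : TwoCell p q) : TwoOneCell p q :=
  (toTwoOne x y).map f

/-- The 2-cell of the free 2-category given by a rewriting sequence. -/
def RewSeq.toTwoCell {p q : P.OneCell x y} (f : RewSeq p q) : TwoCell p q :=
  (CategoryTheory.Quotient.functor (Exchange x y)).map (X := p) (Y := q) f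

/-- The 2-cell of the free (2,1)-category given by a rewriting sequence. -/
def RewSeq.toTwoOneCell {p q : P.OneCell x y} (f : RewSeq p q) : TwoOneCell p q :=
  f.toTwoCell.toTwoOneCell

/-! ## Globular extensions and coherent presentations -/

/-- A globular extension of the free (2,1)-category on `P`: a set of 3-cells `A : s₂ A ⇛ t₂ A`
whose 2-source and 2-target are parallel 2-cells. -/
structure GlobularExtension (P : TwoPolygraph.{u, v, w}) where
  Cell : Type t
  s₀ : Cell → P.Obj
  t₀ : Cell → P.Obj
  s₁ : ∀ A : Cell, P.OneCell (s₀ A) (t₀ A)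
  t₁ : ∀ A : Cell, P.OneCell (s₀ A) (t₀ A)
  s₂ : ∀ A : Cell, TwoOneCell (s₁ A) (t₁ A)
  t₂ : ∀ A : Cell, TwoOneCell (s₁ A) (t₁ A)

namespace GlobularExtension

/-- The (disjoint) union of two globular extensions. -/
def union (Γ Δ : GlobularExtension.{u, v, w, t} P) : GlobularExtension.{u, v, w, t} P where
  Cell := Γ.Cell ⊕ Δ.Cell
  s₀ := fun | .inl A => Γ.s₀ A | .inr A => Δ.s₀ A
  t₀ := fun | .inl A => Γ.t₀ A | .inr A => Δ.t₀ A
  s₁ := fun | .inl A => Γ.s₁ A | .inr A => Δ.s₁ A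
  t₁ := fun | .inl A => Γ.t₁ A | .inr A => Δ.t₁ A
  s₂ := fun | .inl A => Γ.s₂ A | .inr A => Δ.s₂ A
  t₂ := fun | .inl A => Γ.t₂ A | .inr A => Δ.t₂ A

/-- The congruence on the parallel 2-cells of the free (2,1)-category generated by the 3-cells
of `Γ`: the relation `f ≡ g` of equality with respect to `Γ`. -/
inductive Equal (Γ : GlobularExtension.{u, v, w, t} P) :
    ∀ {x y : P.Obj} {p q : P.OneCell x y}, TwoOneCell p q → TwoOneCell p q → Prop
  | gen (A : Γ.Cell) : Equal Γ (Γ.s₂ A) (Γ.t₂ A)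
  | refl {x y : P.Obj} {p q : P.OneCell x y} (f : TwoOneCell p q) : Equal Γ f f
  | symm {x y : P.Obj} {p q : P.OneCell x y} {f g : TwoOneCell p q} :
      Equal Γ f g → Equal Γ g f
  | trans {x y : P.Obj} {p q : P.OneCell x y} {f g h : TwoOneCell p q} :
      Equal Γ f g → Equal Γ g h → Equal Γ f h
  | comp {x y : P.Obj} {p q r : P.OneCell x y} {f f' : TwoOneCell p q} {g g' : TwoOneCell q r} :
      Equal Γ f f' → Equal Γ g g' → Equal Γ (f ≫ g) (f' ≫ g')
  | ctx {x a b y : P.Obj} {p q : P.OneCell a b} {f g : TwoOneCell p q} (u : P.OneCell x a)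
      (v : P.OneCell b y) : Equal Γ f g → Equal Γ (f.ctx u v) (g.ctx u v)

/-- Formal composites representing the 3-cells of the free (3,1)-category on `(P, Γ)`: generators,
identities, 2-composites, inverses, 1-composites and contexts. Every 3-cell of the free
(3,1)-category is represented by such a composite, and the axioms of (3,1)-categories only identify
composites with the same 2-source and 2-target. -/
inductive ThreeCell (Γ : GlobularExtension.{u, v, w, t} P) :
    ∀ {x y : P.Obj} {p q : P.OneCell x y}, TwoOneCell p q → TwoOneCell p q →
      Type (max u v w t)
  | gen (A : Γ.Cell) : ThreeCell Γ (Γ.s₂ A) (Γ.t₂ A)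
  | id {x y : P.Obj} {p q : P.OneCell x y} (f : TwoOneCell p q) : ThreeCell Γ f f
  | inv {x y : P.Obj} {p q : P.OneCell x y} {f g : TwoOneCell p q} :
      ThreeCell Γ f g → ThreeCell Γ g f
  | comp₂ {x y : P.Obj} {p q : P.OneCell x y} {f g h : TwoOneCell p q} :
      ThreeCell Γ f g → ThreeCell Γ g h → ThreeCell Γ f h
  | comp₁ {x y : P.Obj} {p q r : P.OneCell x y} {f f' : TwoOneCell p q}
      {g g' : TwoOneCell q r} :
      ThreeCell Γ f f' → ThreeCell Γ g g' → ThreeCell Γ (f ≫ g) (f' ≫ g')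
  | ctx {x a b y : P.Obj} {p q : P.OneCell a b} {f g : TwoOneCell p q} (u : P.OneCell x a)
      (v : P.OneCell b y) : ThreeCell Γ f g → ThreeCell Γ (f.ctx u v) (g.ctx u v)

/-- `Γ` is a homotopy basis: for every 2-sphere `(f, g)` of the free (2,1)-category there is a
3-cell from `f` to `g` in the free (3,1)-category. -/
def IsHomotopyBasis (Γ : GlobularExtension.{u, v, w, t} P) : Prop :=
  ∀ (x y : P.Obj) (p q : P.OneCell x y) (f g : TwoOneCell p q), Nonempty (ThreeCell Γ f g)

end GlobularExtension

/-! ## Quasi-convergence -/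

/-- `P` is quasi-terminating: each infinite rewriting path visits some 1-cell infinitely often. -/
def IsQuasiTerminating (P : TwoPolygraph.{u, v, w}) : Prop :=
  ∀ (x y : P.Obj) (p : ℕ → P.OneCell x y), (∀ n, Nonempty (P.Step (p n) (p (n + 1)))) →
    ∃ q, {n | p n = q}.Infinite

/-- `P` is confluent: every branching can be completed by a confluence. -/
def IsConfluent (P : TwoPolygraph.{u, v, w}) : Prop :=
  ∀ (x y : P.Obj) (p q r : P.OneCell x y), RewSeq p q → RewSeq p r →
    ∃ s : P.OneCell x y, Nonempty (RewSeq q s) ∧ Nonempty (RewSeq r s)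

/-- `P` is quasi-convergent. -/
def IsQuasiConvergent (P : TwoPolygraph.{u, v, w}) : Prop :=
  P.IsConfluent ∧ P.IsQuasiTerminating

/-- `p` is a quasi-normal form. -/
def IsQuasiNormalForm (p : P.OneCell x y) : Prop :=
  ∀ q : P.OneCell x y, P.Step p q → Nonempty (RewSeq q p)

/-- `s` is a quasi-normal form map: it chooses a quasi-normal form of each 1-cell, the same one
for congruent 1-cells. -/
structure IsQuasiNormalFormMap (s : ∀ {x y : P.Obj}, P.OneCell x y → P.OneCell x y) : Prop where
  isQuasiNormalForm : ∀ {x y : P.Obj} (p : P.OneCell x y), IsQuasiNormalForm (s p)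
  rewrites : ∀ {x y : P.Obj} (p : P.OneCell x y), Nonempty (RewSeq p (s p))
  eq_of_congruent : ∀ {x y : P.Obj} (p q : P.OneCell x y), Congruent p q → s p = s q

/-- The distance from `p` to `q`: the length of a shortest rewriting sequence from `p` to `q`
(only meant to be used if `p` rewrites into `q`). -/
noncomputable def dist (p q : P.OneCell x y) : ℕ :=
  sInf {n | ∃ f : RewSeq p q, Quiver.Path.length f = n}

/-! ## Labellings and local branchings -/

/-- A labelling of the rewriting steps by elements of `W`. -/
def Labelling (P : TwoPolygraph.{u, v, w}) (W : Type*) :=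
  ∀ ⦃x y : P.Obj⦄ ⦃p q : P.OneCell x y⦄, P.Step p q → W

/-- The labelling to the quasi-normal form associated with the quasi-normal form map `s`. -/
noncomputable def qnfLabelling (s : ∀ {x y : P.Obj}, P.OneCell x y → P.OneCell x y) :
    Labelling P ℕ :=
  fun _ _ _ q _ => dist q (s q)

/-- The set of labels of the steps of a rewriting sequence. -/
def RewSeq.labels {W : Type*} (ψ : Labelling P W) {p : P.OneCell x y} :
    ∀ {q : P.OneCell x y}, RewSeq p q → Set W
  | _, .nil => ∅
  | _, .cons f e => insert (ψ e) (RewSeq.labels ψ f)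

/-- A local branching `(f, g)`. -/
structure LocalBranching (P : TwoPolygraph.{u, v, w}) where
  {x y : P.Obj}
  {src left right : P.OneCell x y}
  f : P.Step src left
  g : P.Step src right

namespace LocalBranching

/-- The local branching `(g, f)`. -/
def swap (B : LocalBranching P) : LocalBranching P := ⟨B.g, B.f⟩

/-- The local branching `(u f v, u g v)`. -/
def ctx (B : LocalBranching P) (u : P.OneCell x B.x) (v : P.OneCell B.y y) : LocalBranching P :=
  ⟨B.f.ctx u v, B.g.ctx u v⟩

/-- A local branching `(f, f)`. -/
def IsAspherical (B : LocalBranching P) : Prop :=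
  ∃ (x y : P.Obj) (p q : P.OneCell x y) (f : P.Step p q), B = ⟨f, f⟩

/-- A local branching `(f v, u g)`, with `f : u ⇒ u'` and `g : v ⇒ v'`. -/
def peiffer {p p' : P.OneCell x y} {q q' : P.OneCell y z} (f : P.Step p p') (g : P.Step q q') :
    LocalBranching P :=
  ⟨f.whiskerRight q, g.whiskerLeft p⟩

/-- Being a Peiffer branching, up to the order of the two steps. -/
def IsPeiffer (B : LocalBranching P) : Prop :=
  ∃ (x y z : P.Obj) (p p' : P.OneCell x y) (q q' : P.OneCell y z) (f : P.Step p p')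
    (g : P.Step q q'), B = peiffer f g ∨ B = (peiffer f g).swap

/-- An overlapping branching. -/
def IsOverlapping (B : LocalBranching P) : Prop := ¬ B.IsAspherical ∧ ¬ B.IsPeiffer

/-- The order `⊑` on local branchings: `(f, g) ⊑ (u f v, u g v)`. -/
def Le (B C : LocalBranching P) : Prop :=
  ∃ (x y : P.Obj) (u : P.OneCell x B.x) (v : P.OneCell B.y y), C = B.ctx u v

/-- A critical branching: an overlapping branching that is minimal for `⊑`. -/
def IsCritical (B : LocalBranching P) : Prop :=
  B.IsOverlapping ∧ ∀ C : LocalBranching P, C.Le B → C = B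

/-- A confluence `(f', g')` completing a local branching `(f, g)` into a confluence diagram. -/
structure Completion (B : LocalBranching P) where
  {tgt : P.OneCell B.x B.y}
  f' : RewSeq B.left tgt
  g' : RewSeq B.right tgt

/-- The confluence diagram `(u f v ⋅ u f' v, u g v ⋅ u g' v)`. -/
def Completion.ctx {B : LocalBranching P} (D : B.Completion) (u : P.OneCell x B.x)
    (v : P.OneCell B.y y) : (B.ctx u v).Completion :=
  ⟨D.f'.ctx u v, D.g'.ctx u v⟩

/-- The confluence diagram `(f ⋅ f', g ⋅ g')` is strictly decreasing. -/
def Completion.IsStrictlyDecreasing {B : LocalBranching P} (D : B.Completion) {W : Type*} [LT W]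
    (ψ : Labelling P W) : Prop :=
  (∀ k ∈ D.f'.labels ψ, k < ψ B.f) ∧ (∀ k ∈ D.g'.labels ψ, k < ψ B.g)

end LocalBranching

namespace Labelling

variable {W : Type*} [LT W]

/-- `ψ` is compatible with contexts (in the strictly decreasing sense): contexts preserve strictly
decreasing confluence diagrams of local branchings. -/
def IsCompatibleWithContexts (ψ : Labelling P W) : Prop :=
  ∀ (B : LocalBranching P) (D : B.Completion), D.IsStrictlyDecreasing ψ →
    ∀ (x y : P.Obj) (u : P.OneCell x B.x) (v : P.OneCell B.y y),
      (D.ctx u v).IsStrictlyDecreasing ψ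

/-- `(P, ψ)` is Peiffer decreasing (in the strictly decreasing sense) with respect to `Γ`: each
Peiffer branching `(f v, u g)` has a strictly decreasing confluence diagram
`(f v ⋅ f', u g ⋅ g')` with `u' g ⋆₁ (f v')⁻ ≡ f' ⋆₁ g'⁻` with respect to `Γ`. -/
def IsPeifferDecreasing (ψ : Labelling P W) (Γ : GlobularExtension.{u, v, w, t} P) : Prop :=
  ∀ (x y z : P.Obj) (p p' : P.OneCell x y) (q q' : P.OneCell y z) (f : P.Step p p')
    (g : P.Step q q'), ∃ D : (LocalBranching.peiffer f g).Completion,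
      D.IsStrictlyDecreasing ψ ∧
        Γ.Equal
          ((stepTwoOne x z).map (g.whiskerLeft p') ≫
            Groupoid.inv ((stepTwoOne x z).map (f.whiskerRight q')))
          (D.f'.toTwoOneCell ≫ Groupoid.inv D.g'.toTwoOneCell)

end Labelling

/-! ## Loops -/

/-- A 2-loop of the free 2-category. -/
structure Loop (P : TwoPolygraph.{u, v, w}) where
  {x y : P.Obj}
  {base : P.OneCell x y}
  cell : TwoCell base base

namespace Loop

/-- `g` is obtained from `f` by a circular permutation of the steps in some decomposition of `f`
into rewriting steps: the steps of `a` are moved behind those of `b`. -/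
inductive Rotation : Loop P → Loop P → Prop
  | mk {x y : P.Obj} {p q : P.OneCell x y} (a : RewSeq p q) (b : RewSeq q p) :
      Rotation ⟨RewSeq.toTwoCell (a.comp b)⟩ ⟨RewSeq.toTwoCell (b.comp a)⟩

/-- The equivalence of 2-loops (the equivalence relation generated by circular permutations). -/
def equivalence (P : TwoPolygraph.{u, v, w}) : Setoid (Loop P) := Relation.EqvGen.setoid Rotation

/-- A 2-loop `f` is minimal with respect to 1-composition: `f = g ⋆₁ h ⋆₁ k` with `h` a 2-loop
implies that `h` is an identity or equal to `f`. -/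
def IsMinimalComp (f : Loop P) : Prop :=
  ∀ (q : P.OneCell f.x f.y) (g : TwoCell f.base q) (h : TwoCell q q) (k : TwoCell q f.base),
    f.cell = g ≫ h ≫ k → h = 𝟙 _ ∨ (⟨h⟩ : Loop P) = f

/-- The 2-loop `u f v`. -/
def ctx (f : Loop P) (u : P.OneCell x f.x) (v : P.OneCell f.y y) : Loop P := ⟨f.cell.ctx u v⟩

/-- A 2-loop `f` is minimal by context: there is no decomposition `f = u g v` with `g` a 2-loop
and `u`, `v` not both identities. -/
def IsMinimalCtx (f : Loop P) : Prop :=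
  ∀ (g : Loop P) (x y : P.Obj) (u : P.OneCell x g.x) (v : P.OneCell g.y y),
    f = g.ctx u v → u.IsIdentity ∧ v.IsIdentity

/-- An elementary 2-loop. -/
def IsElementary (f : Loop P) : Prop := f.IsMinimalComp ∧ f.IsMinimalCtx

/-- The equivalence classes of elementary 2-loops. -/
def ElementaryClass (P : TwoPolygraph.{u, v, w}) : Type (max u v w) :=
  {c : Quotient (Loop.equivalence P) // ∃ f : Loop P, f.IsElementary ∧ Quotient.mk _ f = c}

end Loop

/-! ## The strictly decreasing Squier completions -/

/-- The choice of one elementary 2-loop in each equivalence class of elementary 2-loops. -/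
structure LoopChoice (P : TwoPolygraph.{u, v, w}) where
  rep : Loop.ElementaryClass P → Loop P
  isElementary : ∀ c, (rep c).IsElementary
  mk_rep : ∀ c, Quotient.mk (Loop.equivalence P) (rep c) = c.1

/-- The loop extension: one 3-cell `α ⇛ 1` for each chosen elementary 2-loop `α`. -/
def LoopChoice.extension (L : LoopChoice P) : GlobularExtension.{u, v, w, max u v w} P where
  Cell := Loop.ElementaryClass P
  s₀ c := (L.rep c).x
  t₀ c := (L.rep c).y
  s₁ c := (L.rep c).base
  t₁ c := (L.rep c).base
  s₂ c := (L.rep c).cell.toTwoOneCell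
  t₂ _ := 𝟙 _

/-- The choice of a strictly decreasing confluence diagram for each critical branching. A critical
branching `(f, g)` may be represented by `(f, g)` or by `(g, f)`. -/
structure StrictConfluenceChoice {W : Type*} [LT W] (ψ : Labelling P W) where
  branchings : Set (LocalBranching P)
  isCritical : ∀ B ∈ branchings, B.IsCritical
  covers : ∀ B : LocalBranching P, B.IsCritical → B ∈ branchings ∨ B.swap ∈ branchings
  diagram : ∀ B : branchings, B.1.Completion
  isStrictlyDecreasing : ∀ B, (diagram B).IsStrictlyDecreasing ψ

/-- The family of generating strictly decreasing confluences: one 3-cell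
`f ⋆₁ f' ⇛ g ⋆₁ g'` for each chosen confluence diagram. -/
def StrictConfluenceChoice.extension {W : Type*} [LT W] {ψ : Labelling P W}
    (O : StrictConfluenceChoice ψ) : GlobularExtension.{u, v, w, max u v w} P where
  Cell := O.branchings
  s₀ B := B.1.x
  t₀ B := B.1.y
  s₁ B := B.1.src
  t₁ B := (O.diagram B).tgt
  s₂ B := (stepTwoOne _ _).map B.1.f ≫ (O.diagram B).f'.toTwoOneCell
  t₂ B := (stepTwoOne _ _).map B.1.g ≫ (O.diagram B).g'.toTwoOneCell

end TwoPolygraph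

/-- A (3,1)-polygraph: a 2-polygraph with a globular extension of its free (2,1)-category. -/
structure ThreeOnePolygraph where
  base : TwoPolygraph.{u, v, w}
  ext : TwoPolygraph.GlobularExtension.{u, v, w, t} base

/-- A coherent presentation of a category `C`: a (3,1)-polygraph whose underlying 2-polygraph is a
presentation of `C` and whose 3-cells form a homotopy basis. -/
def ThreeOnePolygraph.IsCoherentPresentationOf (Q : ThreeOnePolygraph.{u, v, w, t}) (C : Type*)
    [Category* C] : Prop :=
  Q.base.IsPresentationOf C ∧ Q.ext.IsHomotopyBasis

/-- The data of a strictly decreasing Squier completion of `P` with respect to `ψ`. -/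
structure TwoPolygraph.StrictSquierCompletion {P : TwoPolygraph.{u, v, w}} {W : Type*} [LT W]
    (ψ : TwoPolygraph.Labelling P W) where
  confluences : TwoPolygraph.StrictConfluenceChoice ψ
  loops : TwoPolygraph.LoopChoice P

/-- The strictly decreasing Squier completion, as a (3,1)-polygraph. -/
def TwoPolygraph.StrictSquierCompletion.toThreeOnePolygraph {P : TwoPolygraph.{u, v, w}}
    {W : Type*} [LT W] {ψ : TwoPolygraph.Labelling P W}
    (S : TwoPolygraph.StrictSquierCompletion ψ) :
    ThreeOnePolygraph.{u, v, w, max u v w} where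
  base := P
  ext := S.confluences.extension.union S.loops.extension

/-!
Fix a shortest rewriting sequence from each 1-cell to its quasi-normal form. It suffices to show
that precomposing such a sequence with a step `f : p ⇒ q` gives, up to the 3-cells, such a sequence
for `p`: this property passes to composites and inverses, and it forces parallel 2-cells to be
equal modulo the 3-cells.

The property is proved by induction on the label of `f`, the distance from `q` to its quasi-normal
form. If `p` is its own quasi-normal form, then `f` followed by a shortest sequence from `q` is a
2-loop, and every 2-loop is trivial because it breaks up into elementary ones. Otherwise the
shortest sequence from `p` starts with a step `e` whose label does not exceed that of `f`. A
strictly decreasing confluence diagram of the local branching `(f, e)` then involves only steps with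
smaller labels, to which the induction hypothesis applies.
-/

namespace TwoPolygraph

open OnePolygraph

variable {P : TwoPolygraph.{u, v, w}} {x y z a b : P.Obj}

/-! ## Rewriting sequences as 2-cells -/

namespace RewSeq

variable {p q r : P.OneCell x y}

theorem toTwoCell_surjective :
    Function.Surjective (RewSeq.toTwoCell : RewSeq p q → TwoCell p q) :=
  Quot.exists_rep

theorem toTwoCell_nil (p : P.OneCell x y) : RewSeq.toTwoCell (.nil : RewSeq p p) = 𝟙 _ := rfl

theorem toTwoCell_cons (f : RewSeq p q) (e : P.Step q r) :
    RewSeq.toTwoCell (f.cons e) = f.toTwoCell ≫ (stepTwo x y).map e := rfl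

theorem toTwoCell_comp (f : RewSeq p q) (g : RewSeq q r) :
    RewSeq.toTwoCell (f.comp g) = f.toTwoCell ≫ g.toTwoCell := rfl

end RewSeq

namespace TwoCell

variable {p q r : P.OneCell x y}

theorem toTwoOneCell_id (p : P.OneCell x y) :
    TwoCell.toTwoOneCell (𝟙 ((stepTwo x y).obj p)) = 𝟙 ((stepTwoOne x y).obj p) :=
  (toTwoOne x y).map_id _

theorem toTwoOneCell_comp (f : TwoCell p q) (g : TwoCell q r) :
    TwoCell.toTwoOneCell (f ≫ g) = f.toTwoOneCell ≫ g.toTwoOneCell :=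
  (toTwoOne x y).map_comp f g

theorem toTwoOneCell_step (f : P.Step p q) :
    TwoCell.toTwoOneCell ((stepTwo x y).map f) = (stepTwoOne x y).map f :=
  Category.id_comp ((stepTwoOne x y).map f)

end TwoCell

namespace RewSeq

variable {p q r : P.OneCell x y}

theorem toTwoOneCell_nil (p : P.OneCell x y) :
    RewSeq.toTwoOneCell (.nil : RewSeq p p) = 𝟙 _ :=
  TwoCell.toTwoOneCell_id p

theorem toTwoOneCell_comp (f : RewSeq p q) (g : RewSeq q r) :
    RewSeq.toTwoOneCell (f.comp g) = f.toTwoOneCell ≫ g.toTwoOneCell :=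
  TwoCell.toTwoOneCell_comp f.toTwoCell g.toTwoCell

theorem toTwoOneCell_cons (f : RewSeq p q) (e : P.Step q r) :
    RewSeq.toTwoOneCell (f.cons e) = f.toTwoOneCell ≫ (stepTwoOne x y).map e :=
  (TwoCell.toTwoOneCell_comp f.toTwoCell ((stepTwo x y).map e)).trans
    (congrArg _ (TwoCell.toTwoOneCell_step e))

theorem toTwoOneCell_toPath (e : P.Step p q) :
    RewSeq.toTwoOneCell (Quiver.Hom.toPath e) = (stepTwoOne x y).map e := by
  rw [Quiver.Hom.toPath, toTwoOneCell_cons, toTwoOneCell_nil, Category.id_comp]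

end RewSeq

section Context

variable (u : P.OneCell x a) (v : P.OneCell b y) {p q r : P.OneCell a b}

theorem OneCell.length_ctx (p : P.OneCell a b) :
    Quiver.Path.length (u.ctx p v) =
      Quiver.Path.length u + Quiver.Path.length p + Quiver.Path.length v :=
  (Quiver.Path.length_comp _ _).trans (congrArg (· + _) (Quiver.Path.length_comp _ _))

theorem RewSeq.length_ctx (f : RewSeq p q) : (f.ctx u v).length = f.length := by
  induction f with
  | nil => rfl
  | cons f _ ih => exact congrArg (· + 1) ih

theorem RewSeq.ctx_cons (f : RewSeq p q) (e : P.Step q r) :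
    RewSeq.ctx u (f.cons e) v = (RewSeq.ctx u f v).cons (e.ctx u v) := rfl

theorem TwoCell.ctx_id (p : P.OneCell a b) :
    TwoCell.ctx u (𝟙 ((stepTwo a b).obj p)) v = 𝟙 ((stepTwo x y).obj (u.ctx p v)) :=
  (ctxTwo u v).map_id _

theorem TwoCell.ctx_comp (f : TwoCell p q) (g : TwoCell q r) :
    TwoCell.ctx u (f ≫ g) v = f.ctx u v ≫ g.ctx u v :=
  (ctxTwo u v).map_comp f g

theorem TwoCell.ctx_step (f : P.Step p q) :
    TwoCell.ctx u ((stepTwo a b).map f) v = (stepTwo x y).map (f.ctx u v) :=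
  Category.id_comp ((stepTwo x y).map (f.ctx u v))

theorem TwoOneCell.ctx_id (p : P.OneCell a b) :
    TwoOneCell.ctx u (𝟙 ((stepTwoOne a b).obj p)) v = 𝟙 ((stepTwoOne x y).obj (u.ctx p v)) :=
  (ctxTwoOne u v).map_id _

theorem TwoOneCell.ctx_comp (f : TwoOneCell p q) (g : TwoOneCell q r) :
    TwoOneCell.ctx u (f ≫ g) v = f.ctx u v ≫ g.ctx u v :=
  (ctxTwoOne u v).map_comp f g

theorem TwoOneCell.ctx_step (f : P.Step p q) :
    TwoOneCell.ctx u ((stepTwoOne a b).map f) v = (stepTwoOne x y).map (f.ctx u v) :=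
  Category.id_comp ((stepTwoOne x y).map (f.ctx u v))

theorem RewSeq.toTwoCell_ctx (f : RewSeq p q) : (f.ctx u v).toTwoCell = f.toTwoCell.ctx u v := by
  induction f with
  | nil => exact (TwoCell.ctx_id u v p).symm
  | cons f e ih =>
    rw [RewSeq.ctx_cons, RewSeq.toTwoCell_cons, RewSeq.toTwoCell_cons, TwoCell.ctx_comp,
      TwoCell.ctx_step, ih]

theorem RewSeq.toTwoOneCell_ctx (f : RewSeq p q) :
    (f.ctx u v).toTwoOneCell = f.toTwoOneCell.ctx u v := by
  induction f with
  | nil =>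
    rw [RewSeq.toTwoOneCell_nil, TwoOneCell.ctx_id]
    exact RewSeq.toTwoOneCell_nil _
  | cons f e ih =>
    rw [RewSeq.ctx_cons, RewSeq.toTwoOneCell_cons, RewSeq.toTwoOneCell_cons, TwoOneCell.ctx_comp,
      TwoOneCell.ctx_step, ih]

theorem TwoCell.toTwoOneCell_ctx (f : TwoCell p q) :
    (f.ctx u v).toTwoOneCell = f.toTwoOneCell.ctx u v := by
  obtain ⟨F, rfl⟩ := RewSeq.toTwoCell_surjective f
  rw [← RewSeq.toTwoCell_ctx]
  exact RewSeq.toTwoOneCell_ctx u v F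

end Context

theorem TwoOneCell.induction {motive : ∀ {p q : P.OneCell x y}, TwoOneCell p q → Prop}
    (id : ∀ p : P.OneCell x y, motive (𝟙 ((stepTwoOne x y).obj p)))
    (comp : ∀ {p q r : P.OneCell x y} (F : TwoOneCell p q) (G : TwoOneCell q r),
      motive F → motive G → motive (F ≫ G))
    (step : ∀ {p q : P.OneCell x y} (f : P.Step p q), motive ((stepTwoOne x y).map f))
    (inv : ∀ {p q : P.OneCell x y} (F : TwoOneCell p q), motive F → motive (Groupoid.inv F))
    {p q : P.OneCell x y} (F : TwoOneCell p q) : motive F := by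
  obtain ⟨F, rfl⟩ := Quot.exists_rep F
  obtain ⟨F, rfl⟩ := Quot.exists_rep F
  change Quiver.Path (V := Quiver.Symmetrify (P.OneCell x y)) p q at F
  induction F with
  | nil => exact id p
  | cons F e ih =>
    rcases e with e | e
    · exact comp _ _ ih (step e)
    · exact comp _ _ ih (inv _ (step e))

theorem Step.congruent {p q : P.OneCell x y} (f : P.Step p q) : Congruent p q := by
  obtain ⟨l, e, r, rfl, rfl⟩ := f
  simp only [OneCell.ctx, OneCell.comp_assoc]
  exact Quot.sound (.intro (C := Paths P.Obj) _ _ l _ _ r ⟨e⟩)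

theorem TwoOneCell.congruent {p q : P.OneCell x y} (F : TwoOneCell p q) : Congruent p q := by
  induction F using TwoOneCell.induction with
  | id p => exact rfl
  | comp _ _ hF hG => exact hF.trans hG
  | step f => exact f.congruent
  | inv _ hF => exact hF.symm

/-! ## The length of a 2-cell -/

/-- The functor counting the rewriting steps of a 2-cell of the free 2-category; it exists because
both sides of an exchange relation consist of two steps. -/
def lengthFunctor (x y : P.Obj) : P.FreeTwo x y ⥤ SingleObj (Multiplicative ℕ) :=
  FreeTwo.lift (D := SingleObj (Multiplicative ℕ))
    { obj := fun _ => SingleObj.star _, map := fun _ => Multiplicative.ofAdd 1 } fun _ => rfl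

/-- The number of rewriting steps of a 2-cell of the free 2-category. -/
def TwoCell.length {p q : P.OneCell x y} (f : TwoCell p q) : ℕ :=
  Multiplicative.toAdd (α := ℕ) ((lengthFunctor x y).map f)

theorem TwoCell.length_comp {p q r : P.OneCell x y} (f : TwoCell p q) (g : TwoCell q r) :
    TwoCell.length (f ≫ g) = f.length + g.length := by
  have h := (lengthFunctor x y).map_comp f g
  rw [SingleObj.comp_as_mul] at h
  exact (congrArg (Multiplicative.toAdd (α := ℕ)) h).trans
    ((toAdd_mul (α := ℕ) _ _).trans (add_comm _ _))

theorem RewSeq.length_toTwoCell {p q : P.OneCell x y} (f : RewSeq p q) :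
    f.toTwoCell.length = f.length := by
  induction f with
  | nil => rfl
  | cons f e ih =>
    rw [RewSeq.toTwoCell_cons, TwoCell.length_comp, ih]
    rfl

namespace TwoCell

theorem length_ctx (u : P.OneCell x a) (v : P.OneCell b y) {p q : P.OneCell a b}
    (f : TwoCell p q) : (f.ctx u v).length = f.length := by
  obtain ⟨F, rfl⟩ := RewSeq.toTwoCell_surjective f
  rw [← RewSeq.toTwoCell_ctx, RewSeq.length_toTwoCell, RewSeq.length_toTwoCell, RewSeq.length_ctx]

theorem eq_of_length_eq_zero {p q : P.OneCell x y} {f : TwoCell p q} (h : f.length = 0) :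
    p = q := by
  obtain ⟨F, rfl⟩ := RewSeq.toTwoCell_surjective f
  exact Quiver.Path.eq_of_length_zero F (F.length_toTwoCell ▸ h)

theorem eq_id_of_length_eq_zero {p : P.OneCell x y} {f : TwoCell p p} (h : f.length = 0) :
    f = 𝟙 _ := by
  obtain ⟨F, rfl⟩ := RewSeq.toTwoCell_surjective f
  rw [Quiver.Path.eq_nil_of_length_zero F (F.length_toTwoCell ▸ h), RewSeq.toTwoCell_nil]

end TwoCell

/-! ## Equality with respect to a globular extension -/

variable {Γ : GlobularExtension.{u, v, w, t} P}

namespace GlobularExtension.Equal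

variable {p q r : P.OneCell x y}

instance : Trans (Γ.Equal (p := p) (q := q)) (Γ.Equal (p := p) (q := q))
    (Γ.Equal (p := p) (q := q)) :=
  ⟨.trans⟩

theorem nonempty_threeCell {f g : TwoOneCell p q} (h : Γ.Equal f g) :
    Nonempty (ThreeCell Γ f g) := by
  induction h with
  | gen A => exact ⟨.gen A⟩
  | refl f => exact ⟨.id f⟩
  | symm _ ih => exact ih.map .inv
  | trans _ _ ih₁ ih₂ => exact ih₁.elim fun A => ih₂.map A.comp₂
  | comp _ _ ih₁ ih₂ => exact ih₁.elim fun A => ih₂.map A.comp₁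
  | ctx u v _ ih => exact ih.map (.ctx u v)

theorem comp_left (f : TwoOneCell p q) {g g' : TwoOneCell q r} (h : Γ.Equal g g') :
    Γ.Equal (f ≫ g) (f ≫ g') :=
  .comp (.refl f) h

theorem comp_right {f f' : TwoOneCell p q} (h : Γ.Equal f f') (g : TwoOneCell q r) :
    Γ.Equal (f ≫ g) (f' ≫ g) :=
  .comp h (.refl g)

theorem cancel_right {f f' : TwoOneCell p q} {g : TwoOneCell q r}
    (h : Γ.Equal (f ≫ g) (f' ≫ g)) : Γ.Equal f f' := by
  have := h.comp_right (Groupoid.inv g)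
  rwa [Category.assoc, Category.assoc, Groupoid.comp_inv, Category.comp_id,
    Category.comp_id] at this

theorem comp_eq_id_symm {f : TwoOneCell p q} {g : TwoOneCell q p} (h : Γ.Equal (f ≫ g) (𝟙 _)) :
    Γ.Equal (g ≫ f) (𝟙 _) := by
  refine cancel_right (g := g) ?_
  calc
    (g ≫ f) ≫ g = g ≫ f ≫ g := Category.assoc _ _ _
    Γ.Equal _ (g ≫ 𝟙 _) := h.comp_left g
    _ = 𝟙 _ ≫ g := by rw [Category.comp_id, Category.id_comp]

theorem of_comp_inv {q' o : P.OneCell x y} {f : TwoOneCell p q} {g : TwoOneCell q r}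
    {f' : TwoOneCell p q'} {g' : TwoOneCell q' r} {h : TwoOneCell q o} {h' : TwoOneCell q' o}
    (comm : f ≫ g = f' ≫ g')
    (equal : Γ.Equal (g ≫ Groupoid.inv g') (h ≫ Groupoid.inv h')) :
    Γ.Equal (f ≫ h) (f' ≫ h') := by
  calc
    f ≫ h = f ≫ (h ≫ Groupoid.inv h') ≫ h' := by simp
    Γ.Equal _ (f ≫ (g ≫ Groupoid.inv g') ≫ h') := (equal.symm.comp_right h').comp_left f
    _ = (f ≫ g) ≫ Groupoid.inv g' ≫ h' := by simp only [Category.assoc]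
    _ = f' ≫ h' := by simp [comm]

end GlobularExtension.Equal

/-! ## Triviality of 2-loops -/

namespace Loop

/-- The 2-loop `f` is equal to an identity with respect to `Γ`. -/
def IsTrivial (Γ : GlobularExtension.{u, v, w, t} P) (f : Loop P) : Prop :=
  Γ.Equal f.cell.toTwoOneCell (𝟙 _)

theorem isTrivial_iff_of_equivalence {f g : Loop P} (h : Loop.equivalence P f g) :
    f.IsTrivial Γ ↔ g.IsTrivial Γ := by
  induction h with
  | rel _ _ h =>
    obtain ⟨a, b⟩ := h
    simp only [IsTrivial, RewSeq.toTwoCell_comp, TwoCell.toTwoOneCell_comp]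
    exact ⟨.comp_eq_id_symm, .comp_eq_id_symm⟩
  | refl => exact Iff.rfl
  | symm _ _ _ ih => exact ih.symm
  | trans _ _ _ _ _ ih₁ ih₂ => exact ih₁.trans ih₂

theorem IsTrivial.ctx {f : Loop P} (h : f.IsTrivial Γ) (u : P.OneCell x f.x)
    (v : P.OneCell f.y y) : (f.ctx u v).IsTrivial Γ := by
  have ctx_equal := GlobularExtension.Equal.ctx u v h
  rwa [TwoOneCell.ctx_id, ← TwoCell.toTwoOneCell_ctx] at ctx_equal

theorem IsTrivial.insert {p q : P.OneCell x y} {g : TwoCell p q} {h : TwoCell q q}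
    {k : TwoCell q p} (hgk : IsTrivial Γ ⟨g ≫ k⟩) (hh : IsTrivial Γ ⟨h⟩) :
    IsTrivial Γ ⟨g ≫ h ≫ k⟩ := by
  simp only [IsTrivial, TwoCell.toTwoOneCell_comp] at *
  calc
    g.toTwoOneCell ≫ h.toTwoOneCell ≫ k.toTwoOneCell
    Γ.Equal _ (g.toTwoOneCell ≫ 𝟙 _ ≫ k.toTwoOneCell) := (hh.comp_right _).comp_left _
    _ = g.toTwoOneCell ≫ k.toTwoOneCell := by rw [Category.id_comp]
    Γ.Equal _ (𝟙 _) := hgk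

theorem mk_comp_comp_of_length_eq_zero {p q : P.OneCell x y} {g : TwoCell p q} {k : TwoCell q p}
    (hg : g.length = 0) (hk : k.length = 0) (h : TwoCell q q) :
    (⟨g ≫ h ≫ k⟩ : Loop P) = ⟨h⟩ := by
  obtain rfl := TwoCell.eq_of_length_eq_zero hg
  rw [TwoCell.eq_id_of_length_eq_zero hg, TwoCell.eq_id_of_length_eq_zero hk, Category.id_comp,
    Category.comp_id]

theorem exists_length_lt_of_not_isMinimalComp {f : Loop P} (hf : ¬ f.IsMinimalComp) :
    ∃ (q : P.OneCell f.x f.y) (g : TwoCell f.base q) (h : TwoCell q q) (k : TwoCell q f.base),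
      f.cell = g ≫ h ≫ k ∧ TwoCell.length (g ≫ k) < f.cell.length ∧
        h.length < f.cell.length := by
  simp only [IsMinimalComp, not_forall, not_or, exists_prop] at hf
  obtain ⟨q, g, h, k, hcell, hid, hne⟩ := hf
  have hlen : f.cell.length = g.length + (h.length + k.length) := by
    rw [hcell, TwoCell.length_comp, TwoCell.length_comp]
  have hh : h.length ≠ 0 := fun h₀ => hid (TwoCell.eq_id_of_length_eq_zero h₀)
  have hgk : ¬ (g.length = 0 ∧ k.length = 0) := fun ⟨hg, hk⟩ =>
    hne ((mk_comp_comp_of_length_eq_zero hg hk h).symm.trans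
      (congrArg (fun c => (⟨c⟩ : Loop P)) hcell.symm))
  refine ⟨q, g, h, k, hcell, ?_, by omega⟩
  rw [TwoCell.length_comp]
  omega

theorem exists_length_base_lt_of_not_isMinimalCtx {f : Loop P} (hf : ¬ f.IsMinimalCtx) :
    ∃ (g : Loop P) (x y : P.Obj) (u : P.OneCell x g.x) (v : P.OneCell g.y y),
      f = g.ctx u v ∧ g.cell.length = f.cell.length ∧
        Quiver.Path.length g.base < Quiver.Path.length f.base := by
  simp only [IsMinimalCtx, OneCell.IsIdentity, not_forall, exists_prop] at hf
  obtain ⟨g, x, y, u, v, rfl, huv⟩ := hf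
  have hbase : Quiver.Path.length (g.ctx u v).base = _ := OneCell.length_ctx u v g.base
  exact ⟨g, x, y, u, v, rfl, (TwoCell.length_ctx u v g.cell).symm, by omega⟩

theorem isTrivial_of_forall_isElementary (hΓ : ∀ f : Loop P, f.IsElementary → f.IsTrivial Γ)
    (f : Loop P) : f.IsTrivial Γ := by
  by_cases hcomp : f.IsMinimalComp
  · by_cases hctx : f.IsMinimalCtx
    · exact hΓ f ⟨hcomp, hctx⟩
    · obtain ⟨g, x, y, u, v, hf, hcell, hbase⟩ := exists_length_base_lt_of_not_isMinimalCtx hctx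
      rw [hf]
      exact (isTrivial_of_forall_isElementary hΓ g).ctx u v
  · obtain ⟨q, g, h, k, hcell, hgk, hh⟩ := exists_length_lt_of_not_isMinimalComp hcomp
    have : IsTrivial Γ ⟨g ≫ h ≫ k⟩ :=
      (isTrivial_of_forall_isElementary hΓ ⟨g ≫ k⟩).insert
        (isTrivial_of_forall_isElementary hΓ ⟨h⟩)
    rwa [← hcell] at this
termination_by (f.cell.length, Quiver.Path.length f.base)
decreasing_by
  · exact Prod.lex_def.2 (.inr ⟨hcell, hbase⟩)
  · exact Prod.Lex.left _ _ hgk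
  · exact Prod.Lex.left _ _ hh

end Loop

/-! ## Strictly decreasing confluence diagrams -/

namespace LocalBranching

variable {W : Type*} [LT W] {ψ : Labelling P W}

/-- The local branching `B` has a strictly decreasing confluence diagram whose two sides are equal
with respect to `Γ`. -/
def HasStrictDiagram (ψ : Labelling P W) (Γ : GlobularExtension.{u, v, w, t} P)
    (B : LocalBranching P) : Prop :=
  ∃ D : B.Completion, D.IsStrictlyDecreasing ψ ∧
    Γ.Equal ((stepTwoOne _ _).map B.f ≫ D.f'.toTwoOneCell)
      ((stepTwoOne _ _).map B.g ≫ D.g'.toTwoOneCell)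

namespace HasStrictDiagram

variable {B : LocalBranching P}

theorem swap (h : B.HasStrictDiagram ψ Γ) : B.swap.HasStrictDiagram ψ Γ :=
  let ⟨D, hD, e⟩ := h
  ⟨⟨D.g', D.f'⟩, hD.symm, e.symm⟩

theorem ctx (hψ : ψ.IsCompatibleWithContexts) (h : B.HasStrictDiagram ψ Γ) (u : P.OneCell x B.x)
    (v : P.OneCell B.y y) : (B.ctx u v).HasStrictDiagram ψ Γ := by
  obtain ⟨D, hD, e⟩ := h
  refine ⟨D.ctx u v, hψ B D hD x y u v, ?_⟩
  have ctx_step_comp {p q r : P.OneCell B.x B.y} (f : P.Step p q) (g : RewSeq q r) :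
      TwoOneCell.ctx u ((stepTwoOne _ _).map f ≫ g.toTwoOneCell) v =
        (stepTwoOne _ _).map (f.ctx u v) ≫ (g.ctx u v).toTwoOneCell := by
    rw [TwoOneCell.ctx_comp, TwoOneCell.ctx_step, RewSeq.toTwoOneCell_ctx]
  have := GlobularExtension.Equal.ctx u v e
  rwa [ctx_step_comp, ctx_step_comp] at this

theorem of_isAspherical (h : B.IsAspherical) : B.HasStrictDiagram ψ Γ := by
  obtain ⟨x, y, p, q, f, rfl⟩ := h
  exact ⟨⟨.nil, .nil⟩, ⟨fun _ hk => hk.elim, fun _ hk => hk.elim⟩, .refl _⟩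

theorem of_isPeiffer (hψ : ψ.IsPeifferDecreasing Γ) (h : B.IsPeiffer) :
    B.HasStrictDiagram ψ Γ := by
  obtain ⟨x, y, z, p, p', q, q', f, g, h⟩ := h
  have peiffer_hasStrictDiagram : (peiffer f g).HasStrictDiagram ψ Γ := by
    obtain ⟨D, hD, e⟩ := hψ x y z p p' q q' f g
    exact ⟨D, hD, .of_comp_inv (stepTwoOne_exchange (.mk f g)) e⟩
  rcases h with rfl | rfl
  exacts [peiffer_hasStrictDiagram, peiffer_hasStrictDiagram.swap]

end HasStrictDiagram

theorem mk_eq_mk_of_heq {p q r p' q' r' : P.OneCell x y} {f : P.Step p q} {g : P.Step p r}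
    {f' : P.Step p' q'} {g' : P.Step p' r'} (hp : p = p') (hq : q = q') (hr : r = r')
    (hf : f ≍ f') (hg : g ≍ g') : (⟨f, g⟩ : LocalBranching P) = ⟨f', g'⟩ := by
  subst hp hq hr
  rw [eq_of_heq hf, eq_of_heq hg]

theorem ctx_id (B : LocalBranching P) : B.ctx (OneCell.id B.x) (OneCell.id B.y) = B := by
  have oneCell_ctx_id (p : P.OneCell B.x B.y) : (OneCell.id B.x).ctx p (OneCell.id B.y) = p :=
    Quiver.Path.nil_comp p
  have step_ctx_id {p q : P.OneCell B.x B.y} (f : P.Step p q) :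
      f.ctx (OneCell.id B.x) (OneCell.id B.y) ≍ f :=
    Step.heq_of_data (oneCell_ctx_id p) (oneCell_ctx_id q) _ _ _ (Quiver.Path.nil_comp f.left) rfl
      f.source_eq f.target_eq
  exact mk_eq_mk_of_heq (oneCell_ctx_id _) (oneCell_ctx_id _) (oneCell_ctx_id _) (step_ctx_id _)
    (step_ctx_id _)

theorem Le.length_src_lt {B C : LocalBranching P} (h : C.Le B) (hne : C ≠ B) :
    Quiver.Path.length C.src < Quiver.Path.length B.src := by
  obtain ⟨x, y, u, v, rfl⟩ := h
  have hlen : Quiver.Path.length (C.ctx u v).src = _ := OneCell.length_ctx u v C.src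
  by_contra hlt
  have hu : Quiver.Path.length u = 0 := by omega
  have hv : Quiver.Path.length v = 0 := by omega
  obtain rfl := Quiver.Path.eq_of_length_zero u hu
  obtain rfl := Quiver.Path.eq_of_length_zero v hv
  obtain rfl := Quiver.Path.eq_nil_of_length_zero u hu
  obtain rfl := Quiver.Path.eq_nil_of_length_zero v hv
  exact hne C.ctx_id.symm

theorem hasStrictDiagram_of_forall_isCritical (hctx : ψ.IsCompatibleWithContexts)
    (hPeiffer : ψ.IsPeifferDecreasing Γ)
    (hcrit : ∀ B : LocalBranching P, B.IsCritical → B.HasStrictDiagram ψ Γ)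
    (B : LocalBranching P) : B.HasStrictDiagram ψ Γ := by
  by_cases haspherical : B.IsAspherical
  · exact .of_isAspherical haspherical
  by_cases hpeiffer : B.IsPeiffer
  · exact .of_isPeiffer hPeiffer hpeiffer
  by_cases hmin : ∀ C : LocalBranching P, C.Le B → C = B
  · exact hcrit B ⟨⟨haspherical, hpeiffer⟩, hmin⟩
  · push Not at hmin
    obtain ⟨C, hle, hne⟩ := hmin
    have hlt := hle.length_src_lt hne
    obtain ⟨x, y, u, v, rfl⟩ := hle
    exact (hasStrictDiagram_of_forall_isCritical hctx hPeiffer hcrit C).ctx hctx u v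
termination_by Quiver.Path.length B.src

end LocalBranching

/-! ## Shortest rewriting sequences to the quasi-normal form -/

theorem dist_le_length {p q : P.OneCell x y} (f : RewSeq p q) : dist p q ≤ f.length :=
  Nat.sInf_le ⟨f, rfl⟩

theorem RewSeq.exists_length_eq_dist {p q : P.OneCell x y} (f : RewSeq p q) :
    ∃ g : RewSeq p q, g.length = dist p q :=
  Nat.sInf_mem (s := {n | ∃ g : RewSeq p q, Quiver.Path.length g = n}) ⟨_, f, rfl⟩

variable {s : ∀ {x y : P.Obj}, P.OneCell x y → P.OneCell x y} {p q r z : P.OneCell x y}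

/-- `f` is a shortest rewriting sequence from `p` to its quasi-normal form. The target `z` is a
variable because `s p` and `s q` are only propositionally equal when `p` rewrites into `q`. -/
def RewSeq.IsShortestNormalization (s : ∀ {x y : P.Obj}, P.OneCell x y → P.OneCell x y)
    (f : RewSeq p z) : Prop :=
  s p = z ∧ f.length = dist p (s p)

namespace IsQuasiNormalFormMap

theorem eq_of_twoOneCell (hs : IsQuasiNormalFormMap s) (F : TwoOneCell p q) : s p = s q :=
  hs.eq_of_congruent p q F.congruent

theorem eq_of_step (hs : IsQuasiNormalFormMap s) (f : P.Step p q) : s p = s q :=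
  hs.eq_of_congruent p q f.congruent

theorem exists_isShortestNormalization (hs : IsQuasiNormalFormMap s) (hz : s p = z) :
    ∃ σ : RewSeq p z, σ.IsShortestNormalization s := by
  subst hz
  obtain ⟨f⟩ := hs.rewrites p
  exact f.exists_length_eq_dist.imp fun _ hσ => ⟨rfl, hσ⟩

theorem dist_le_qnfLabelling_add_one (hs : IsQuasiNormalFormMap s) (f : P.Step p q) :
    dist p (s p) ≤ qnfLabelling s f + 1 := by
  obtain ⟨σ, -, hσ⟩ := hs.exists_isShortestNormalization (hs.eq_of_step f).symm
  calc
    dist p (s p) ≤ ((Quiver.Hom.toPath f).comp σ).length := dist_le_length _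
    _ = σ.length + 1 := by rw [Quiver.Path.length_comp, Quiver.Path.length_toPath, add_comm]
    _ = dist q (s q) + 1 := congrArg (· + 1) hσ

end IsQuasiNormalFormMap

theorem RewSeq.IsShortestNormalization.exists_eq_toPath_comp {σ : RewSeq p z}
    (hσ : σ.IsShortestNormalization s) (hs : IsQuasiNormalFormMap s) (hlen : σ.length ≠ 0) :
    ∃ (q : P.OneCell x y) (e : P.Step p q) (τ : RewSeq q z), σ = (Quiver.Hom.toPath e).comp τ ∧
      τ.IsShortestNormalization s ∧ qnfLabelling s e < dist p (s p) := by
  obtain ⟨q, e, τ, rfl, -⟩ := (Quiver.Path.length_ne_zero_iff_eq_comp σ).1 hlen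
  obtain ⟨hz, hσ⟩ := hσ
  have hlen_eq : 1 + τ.length = dist p (s p) := by
    rwa [Quiver.Path.length_comp, Quiver.Path.length_toPath] at hσ
  have hqz : s q = z := (hs.eq_of_step e).symm.trans hz
  have hdist_le : dist q (s q) ≤ τ.length := by
    rw [hqz]
    exact dist_le_length τ
  have hle_dist : dist p (s p) ≤ dist q (s q) + 1 := hs.dist_le_qnfLabelling_add_one e
  have hτ : τ.length = dist q (s q) := by omega
  have hlt : dist q (s q) < dist p (s p) := by omega
  exact ⟨q, e, τ, rfl, ⟨hqz, hτ⟩, hlt⟩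

/-! ## Coherence -/

/-- Composing the 2-cell `F` with any shortest rewriting sequence to the quasi-normal form yields
any shortest rewriting sequence to the quasi-normal form, up to `Γ`. -/
def TwoOneCell.IsCoherent (s : ∀ {x y : P.Obj}, P.OneCell x y → P.OneCell x y)
    (Γ : GlobularExtension.{u, v, w, t} P) (F : TwoOneCell p q) : Prop :=
  ∀ ⦃z : P.OneCell x y⦄ ⦃σ : RewSeq q z⦄ ⦃τ : RewSeq p z⦄, σ.IsShortestNormalization s →
    τ.IsShortestNormalization s → Γ.Equal (F ≫ σ.toTwoOneCell) τ.toTwoOneCell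

namespace TwoOneCell.IsCoherent

theorem id_of_forall_step (hs : IsQuasiNormalFormMap s)
    (H : ∀ {q : P.OneCell x y} (e : P.Step p q), qnfLabelling s e < dist p (s p) →
      TwoOneCell.IsCoherent s Γ ((stepTwoOne x y).map e)) :
    TwoOneCell.IsCoherent s Γ (𝟙 ((stepTwoOne x y).obj p)) := by
  intro z σ τ hσ hτ
  rw [Category.id_comp]
  by_cases hlen : σ.length = 0
  · have hlen' : τ.length = 0 := hτ.2.trans (hσ.2.symm.trans hlen)
    obtain rfl := Quiver.Path.eq_of_length_zero σ hlen
    rw [Quiver.Path.eq_nil_of_length_zero σ hlen, Quiver.Path.eq_nil_of_length_zero τ hlen']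
    exact .refl _
  · obtain ⟨q, e, σ', rfl, hσ', hlt⟩ := hσ.exists_eq_toPath_comp hs hlen
    rw [RewSeq.toTwoOneCell_comp, RewSeq.toTwoOneCell_toPath]
    exact H e hlt hσ' hτ

theorem comp (hs : IsQuasiNormalFormMap s) {F : TwoOneCell p q} {G : TwoOneCell q r}
    (hF : F.IsCoherent s Γ) (hG : G.IsCoherent s Γ) : TwoOneCell.IsCoherent s Γ (F ≫ G) := by
  intro z σ τ hσ hτ
  obtain ⟨ρ, hρ⟩ := hs.exists_isShortestNormalization ((hs.eq_of_twoOneCell G).trans hσ.1)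
  calc
    (F ≫ G) ≫ σ.toTwoOneCell = F ≫ G ≫ σ.toTwoOneCell := Category.assoc _ _ _
    Γ.Equal _ (F ≫ ρ.toTwoOneCell) := (hG hσ hρ).comp_left F
    Γ.Equal _ τ.toTwoOneCell := hF hρ hτ

theorem inv {F : TwoOneCell p q} (hF : F.IsCoherent s Γ) :
    TwoOneCell.IsCoherent s Γ (Groupoid.inv F) := by
  intro z σ τ hσ hτ
  calc
    Γ.Equal (Groupoid.inv F ≫ σ.toTwoOneCell) (Groupoid.inv F ≫ F ≫ τ.toTwoOneCell) :=
      (hF hτ hσ).symm.comp_left _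
    _ = τ.toTwoOneCell := by simp

theorem equal (hs : IsQuasiNormalFormMap s) {F G : TwoOneCell p q} (hF : F.IsCoherent s Γ)
    (hG : G.IsCoherent s Γ) : Γ.Equal F G := by
  obtain ⟨σ, hσ⟩ := hs.exists_isShortestNormalization (p := q) rfl
  obtain ⟨τ, hτ⟩ := hs.exists_isShortestNormalization (hs.eq_of_twoOneCell F)
  exact ((hF hσ hτ).trans (hG hσ hτ).symm).cancel_right

theorem comp_equal_comp (hs : IsQuasiNormalFormMap s) {q' o : P.OneCell x y}
    {F : TwoOneCell p q} {G : TwoOneCell p q'} {F' : TwoOneCell q o} {G' : TwoOneCell q' o}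
    (hF' : F'.IsCoherent s Γ) (hG' : G'.IsCoherent s Γ) (h : Γ.Equal (F ≫ F') (G ≫ G'))
    {σ : RewSeq q z} {τ : RewSeq q' z} (hσ : σ.IsShortestNormalization s)
    (hτ : τ.IsShortestNormalization s) :
    Γ.Equal (F ≫ σ.toTwoOneCell) (G ≫ τ.toTwoOneCell) := by
  obtain ⟨ρ, hρ⟩ := hs.exists_isShortestNormalization ((hs.eq_of_twoOneCell F').symm.trans hσ.1)
  calc
    Γ.Equal (F ≫ σ.toTwoOneCell) (F ≫ F' ≫ ρ.toTwoOneCell) := (hF' hρ hσ).symm.comp_left F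
    _ = (F ≫ F') ≫ ρ.toTwoOneCell := (Category.assoc _ _ _).symm
    Γ.Equal _ ((G ≫ G') ≫ ρ.toTwoOneCell) := h.comp_right _
    _ = G ≫ G' ≫ ρ.toTwoOneCell := Category.assoc _ _ _
    Γ.Equal _ (G ≫ τ.toTwoOneCell) := (hG' hρ hτ).comp_left G

end TwoOneCell.IsCoherent

theorem RewSeq.isCoherent_of_labels_lt (hs : IsQuasiNormalFormMap s) {n : ℕ}
    (H : ∀ {q r : P.OneCell x y} (e : P.Step q r), qnfLabelling s e < n →
      TwoOneCell.IsCoherent s Γ ((stepTwoOne x y).map e))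
    (hp : dist p (s p) ≤ n) (f : RewSeq p q) (hf : ∀ k ∈ f.labels (qnfLabelling s), k < n) :
    TwoOneCell.IsCoherent s Γ f.toTwoOneCell := by
  induction f with
  | nil =>
    rw [RewSeq.toTwoOneCell_nil]
    exact .id_of_forall_step hs fun e he => H e (he.trans_le hp)
  | cons f e ih =>
    rw [RewSeq.toTwoOneCell_cons]
    exact .comp hs (ih fun k hk => hf k (Set.mem_insert_of_mem _ hk))
      (H e (hf _ (Set.mem_insert _ _)))

theorem Step.isCoherent (hs : IsQuasiNormalFormMap s) (hloop : ∀ f : Loop P, f.IsTrivial Γ)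
    (hloc : ∀ B : LocalBranching P, B.HasStrictDiagram (qnfLabelling s) Γ) (f : P.Step p q) :
    TwoOneCell.IsCoherent s Γ ((stepTwoOne x y).map f) := by
  induction hn : qnfLabelling s f using Nat.strong_induction_on generalizing p q with
  | _ n ih =>
  intro z σ τ hσ hτ
  by_cases hlen : τ.length = 0
  · obtain rfl := Quiver.Path.eq_of_length_zero τ hlen
    rw [Quiver.Path.eq_nil_of_length_zero τ hlen, RewSeq.toTwoOneCell_nil,
      ← RewSeq.toTwoOneCell_toPath, ← RewSeq.toTwoOneCell_comp]
    exact hloop ⟨RewSeq.toTwoCell ((Quiver.Hom.toPath f).comp σ)⟩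
  · obtain ⟨r, e, τ', rfl, hτ', hlt⟩ := hτ.exists_eq_toPath_comp hs hlen
    have hle : qnfLabelling s e ≤ n := by
      have := hs.dist_le_qnfLabelling_add_one f
      omega
    obtain ⟨⟨f', g'⟩, ⟨hf', hg'⟩, hfg⟩ := hloc ⟨f, e⟩
    have coherent_of_lt {q r : P.OneCell x y} (e : P.Step q r) (he : qnfLabelling s e < n) :=
      ih _ he e rfl
    have f'_coherent : f'.toTwoOneCell.IsCoherent s Γ :=
      f'.isCoherent_of_labels_lt hs coherent_of_lt hn.le fun k hk => (hf' k hk).trans_eq hn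
    have g'_coherent : g'.toTwoOneCell.IsCoherent s Γ :=
      g'.isCoherent_of_labels_lt hs coherent_of_lt hle fun k hk => (hg' k hk).trans_le hle
    rw [RewSeq.toTwoOneCell_comp, RewSeq.toTwoOneCell_toPath]
    exact TwoOneCell.IsCoherent.comp_equal_comp hs f'_coherent g'_coherent hfg hσ hτ'

theorem GlobularExtension.isHomotopyBasis_of_forall_step (hs : IsQuasiNormalFormMap s)
    (H : ∀ {x y : P.Obj} {p q : P.OneCell x y} (f : P.Step p q),
      TwoOneCell.IsCoherent s Γ ((stepTwoOne x y).map f)) :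
    Γ.IsHomotopyBasis := by
  have coherent {x y : P.Obj} {p q : P.OneCell x y} (F : TwoOneCell p q) : F.IsCoherent s Γ := by
    induction F using TwoOneCell.induction with
    | id p => exact .id_of_forall_step hs fun e _ => H e
    | comp _ _ hF hG => exact hF.comp hs hG
    | step f => exact H f
    | inv _ hF => exact hF.inv
  exact fun x y p q F G => ((coherent F).equal hs (coherent G)).nonempty_threeCell

namespace StrictSquierCompletion

variable {W : Type*} [LT W] {ψ : Labelling P W} (S : StrictSquierCompletion ψ)

theorem hasStrictDiagram_of_isCritical (B : LocalBranching P) (hB : B.IsCritical) :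
    B.HasStrictDiagram ψ S.toThreeOnePolygraph.ext := by
  have of_mem (B) (hB : B ∈ S.confluences.branchings) :
      B.HasStrictDiagram ψ S.toThreeOnePolygraph.ext :=
    ⟨S.confluences.diagram ⟨B, hB⟩, S.confluences.isStrictlyDecreasing ⟨B, hB⟩,
      .gen (Γ := S.toThreeOnePolygraph.ext) (.inl ⟨B, hB⟩)⟩
  rcases S.confluences.covers B hB with h | h
  exacts [of_mem B h, (of_mem B.swap h).swap]

theorem isTrivial_of_isElementary (f : Loop P) (hf : f.IsElementary) :
    f.IsTrivial S.toThreeOnePolygraph.ext := by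
  let c : Loop.ElementaryClass P := ⟨Quotient.mk _ f, f, hf, rfl⟩
  have rep_isTrivial : (S.loops.rep c).IsTrivial S.toThreeOnePolygraph.ext :=
    .gen (Γ := S.toThreeOnePolygraph.ext) (.inr c)
  exact (Loop.isTrivial_iff_of_equivalence (Quotient.exact (S.loops.mk_rep c))).1 rep_isTrivial

end StrictSquierCompletion

end TwoPolygraph

theorem mainTheorem2_general (P : TwoPolygraph.{u, v, w})
    (s : ∀ {x y : P.Obj}, P.OneCell x y → P.OneCell x y)
    (hs : TwoPolygraph.IsQuasiNormalFormMap s)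
    (S : TwoPolygraph.StrictSquierCompletion (TwoPolygraph.qnfLabelling s))
    (hctx : (TwoPolygraph.qnfLabelling s).IsCompatibleWithContexts)
    (hPeiffer : (TwoPolygraph.qnfLabelling s).IsPeifferDecreasing S.toThreeOnePolygraph.ext) :
    S.toThreeOnePolygraph.IsCoherentPresentationOf P.PresentedCategory := by
  refine ⟨⟨𝟭 _, 𝟭 _, rfl, rfl⟩, ?_⟩
  have loop_isTrivial (f : TwoPolygraph.Loop P) : f.IsTrivial S.toThreeOnePolygraph.ext :=
    f.isTrivial_of_forall_isElementary S.isTrivial_of_isElementary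
  have branching_hasStrictDiagram (B : TwoPolygraph.LocalBranching P) :
      B.HasStrictDiagram (TwoPolygraph.qnfLabelling s) S.toThreeOnePolygraph.ext :=
    B.hasStrictDiagram_of_forall_isCritical hctx hPeiffer S.hasStrictDiagram_of_isCritical
  exact TwoPolygraph.GlobularExtension.isHomotopyBasis_of_forall_step hs fun f =>
    f.isCoherent hs loop_isTrivial branching_hasStrictDiagram

theorem mainTheorem2 (P : TwoPolygraph.{u, v, w}) (hP : P.IsQuasiConvergent)
    (s : ∀ {x y : P.Obj}, P.OneCell x y → P.OneCell x y)
    (hs : TwoPolygraph.IsQuasiNormalFormMap s)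
    (S : TwoPolygraph.StrictSquierCompletion (TwoPolygraph.qnfLabelling s))
    (hctx : (TwoPolygraph.qnfLabelling s).IsCompatibleWithContexts)
    (hPeiffer : (TwoPolygraph.qnfLabelling s).IsPeifferDecreasing S.toThreeOnePolygraph.ext) :
    S.toThreeOnePolygraph.IsCoherentPresentationOf P.PresentedCategory :=
  mainTheorem2_general P s hs S hctx hPeiffer
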